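/- Let $F$ be a field and let $A$ be a finite-dimensional unital (not necessarily associative) $F$-algebra. Write $(x,y,z)=(xy)z-x(yz)$. The nucleus $\mathrm{Nuc}(A)$ is the set of $x\in A$ with $(x,a,b)=(a,x,b)=(a,b,x)=0$ for all $a,b\in A$; it is an associative $F$-subalgebra of $A$. The center of $A$ is the set of elements of $\mathrm{Nuc}(A)$ commuting with every element of $A$, and $A$ is $F$-central if $c\mapsto c\cdot 1$ is an isomorphism from $F$ onto the center. A module over a ring is minimally faithful if it is faithful and no proper section of it (a quotient $N/N'$ of submodules $N'\subseteq N$, other than the module itself) is faithful. The algebra $A$ is semiassociative if it is $F$-central and there is a commutative étale $F$-subalgebra $K\subseteq \mathrm{Nuc}(A)$ (containing $1$) such that $A$ is minimally faithful as a module over $K\otimes_F K$ via $(k\otimes k')a=kak'$. Put $\sigma(A)=\mathrm{Nuc}(A)/\mathrm{Jac}(\mathrm{Nuc}(A))$, where $\mathrm{Jac}$ is the Jacobson radical. Let $A$ be a semiassociative $F$-algebra. Then $\sigma(A)$ is a separable $F$-algebra, i.e. it is projective as a module over $\sigma(A)\otimes_F\sigma(A)^{\mathrm{op}}$. Moreover,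 there is an injective $F$-algebra homomorphism $s\colon\sigma(A)\to\mathrm{Nuc}(A)$ which is a section of the quotient map $\mathrm{Nuc}(A)\to\sigma(A)$, and $$\mathrm{Nuc}(A)=s(\sigma(A))\oplus \mathrm{Jac}(\mathrm{Nuc}(A))$$ as $F$-vector spaces. -/

import Mathlib

open scoped TensorProduct

section Nucleus

/-- The nucleus of a unital nonassociative ring: the elements whose associators
`(x, a, b)`, `(a, x, b)`, `(a, b, x)` all vanish. -/
def nucleus (A : Type*) [NonAssocRing A] : Subring A where
  carrier := {x | (∀ a b : A, associator x a b = 0) ∧ (∀ a b : A, associator a x b = 0) ∧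
    (∀ a b : A, associator a b x = 0)}
  mul_mem' := by
    rintro x y ⟨hx1, hx2, hx3⟩ ⟨hy1, hy2, hy3⟩
    simp only [associator_apply, sub_eq_zero] at *
    refine ⟨fun a b => ?_, fun a b => ?_, fun a b => ?_⟩
    · rw [hx1, hx1, hx1, hy1]
    · rw [← hx2, hy2, hx2, hx1]
    · rw [← hy3, hx3, hy3, hy3]
  one_mem' := by simp [associator_apply]
  add_mem' := by
    rintro x y ⟨hx1, hx2, hx3⟩ ⟨hy1, hy2, hy3⟩
    simp only [Set.mem_ofPred_eq, associator_apply, sub_eq_zero] at *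
    simp [add_mul, mul_add, hx1, hx2, hx3, hy1, hy2, hy3]
  zero_mem' := by simp [associator_apply]
  neg_mem' := by
    rintro x ⟨hx1, hx2, hx3⟩
    simp only [Set.mem_ofPred_eq, associator_apply, sub_eq_zero] at *
    simp [hx1, hx2, hx3]

namespace nucleus

theorem left_assoc {A : Type*} [NonAssocRing A] (x : nucleus A) (a b : A) :
    (x : A) * a * b = x * (a * b) := sub_eq_zero.1 (x.2.1 a b)

theorem mid_assoc {A : Type*} [NonAssocRing A] (x : nucleus A) (a b : A) :
    a * (x : A) * b = a * (x * b) := sub_eq_zero.1 (x.2.2.1 a b)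

theorem right_assoc {A : Type*} [NonAssocRing A] (x : nucleus A) (a b : A) :
    a * b * (x : A) = a * (b * x) := sub_eq_zero.1 (x.2.2.2 a b)

/-- The nucleus is an associative ring. -/
instance instRing (A : Type*) [NonAssocRing A] : Ring (nucleus A) where
  __ := SubringClass.toNonAssocRing (nucleus A)
  mul_assoc x y z := Subtype.ext (left_assoc x y z)

instance instSMul (F A : Type*) [Field F] [NonAssocRing A] [Module F A] [IsScalarTower F A A]
    [SMulCommClass F A A] : SMul F (nucleus A) where
  smul c x := ⟨c • (x : A), by
    refine ⟨fun a b => ?_, fun a b => ?_, fun a b => ?_⟩ <;>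
    simp [associator_apply, smul_mul_assoc, mul_smul_comm, left_assoc, mid_assoc,
      right_assoc]⟩

instance instModule (F A : Type*) [Field F] [NonAssocRing A] [Module F A] [IsScalarTower F A A]
    [SMulCommClass F A A] : Module F (nucleus A) :=
  Function.Injective.module F (nucleus A).toAddSubgroup.subtype Subtype.val_injective
    (fun _ _ => rfl)

/-- The nucleus of a nonassociative `F`-algebra is an associative `F`-algebra. -/
instance instAlgebra (F A : Type*) [Field F] [NonAssocRing A] [Module F A] [IsScalarTower F A A]
    [SMulCommClass F A A] : Algebra F (nucleus A) :=
  Algebra.ofModule (fun c x y => Subtype.ext (smul_mul_assoc c (x : A) (y : A)))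
    (fun c x y => Subtype.ext (mul_smul_comm c (x : A) (y : A)))

end nucleus

/-- The semisimple quotient `Nuc(A) / Jac(Nuc(A))` of the nucleus. -/
abbrev semisimpleQuotient (A : Type*) [NonAssocRing A] : Type _ :=
  nucleus A ⧸ Ring.jacobson (nucleus A)

end Nucleus

section Semiassociative

/-- A module is minimally faithful if it is faithful and no proper section
(a quotient `N / N'` of submodules `N' ≤ N`, other than `M / 0` itself) is faithful. -/
def IsMinimallyFaithful (R M : Type*) [Ring R] [AddCommGroup M] [Module R M] : Prop :=
  FaithfulSMul R M ∧ ∀ N' N : Submodule R M, N' ≤ N →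
    FaithfulSMul R (N ⧸ N'.submoduleOf N) → N' = ⊥ ∧ N = ⊤

/-- The algebra `A` is `F`-central: the structure map `c ↦ c • 1` is injective with image the
center of `A` (the elements of the nucleus commuting with all of `A`). -/
def IsCentralNonAssoc (F A : Type*) [Field F] [NonAssocRing A] [Module F A] : Prop :=
  Function.Injective (fun c : F => c • (1 : A)) ∧
    Set.range (fun c : F => c • (1 : A)) = Set.center A

open scoped IsMulCommutative

/-- Left multiplication of a subalgebra of the nucleus on `A`. -/
def nucLeft (F A : Type*) [Field F] [NonAssocRing A] [Module F A] [IsScalarTower F A A]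
    [SMulCommClass F A A] (K : Subalgebra F (nucleus A)) : K →ₐ[F] Module.End F A :=
  AlgHom.ofLinearMap
    { toFun := fun k => LinearMap.mulLeft F ((k : nucleus A) : A)
      map_add' := fun x y => LinearMap.ext fun a => add_mul (x.1 : A) (y.1 : A) a
      map_smul' := fun c x => LinearMap.ext fun a => smul_mul_assoc c (x.1 : A) a }
    (LinearMap.ext fun a => one_mul a)
    (fun x y => LinearMap.ext fun a => nucleus.left_assoc x.1 (y.1 : A) a)

/-- Right multiplication of a commutative subalgebra of the nucleus on `A`. -/
def nucRight (F A : Type*) [Field F] [NonAssocRing A] [Module F A] [IsScalarTower F A A]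
    [SMulCommClass F A A] (K : Subalgebra F (nucleus A)) [IsMulCommutative K] :
    K →ₐ[F] Module.End F A :=
  AlgHom.ofLinearMap
    { toFun := fun k => LinearMap.mulRight F ((k : nucleus A) : A)
      map_add' := fun x y => LinearMap.ext fun a => mul_add a (x.1 : A) (y.1 : A)
      map_smul' := fun c x => LinearMap.ext fun a => mul_smul_comm c a (x.1 : A) }
    (LinearMap.ext fun a => mul_one a)
    (fun x y => LinearMap.ext fun a => by
      rw [mul_comm x y]
      exact (nucleus.right_assoc x.1 a (y.1 : A)).symm)

/-- The action `(k ⊗ k') a = k a k'` of `K ⊗ K` on `A`, for a commutative subalgebra `K` of the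
nucleus. -/
def nucBiact (F A : Type*) [Field F] [NonAssocRing A] [Module F A] [IsScalarTower F A A]
    [SMulCommClass F A A] (K : Subalgebra F (nucleus A)) [IsMulCommutative K] :
    K ⊗[F] K →ₐ[F] Module.End F A :=
  Algebra.TensorProduct.lift (nucLeft F A K) (nucRight F A K) (fun x y =>
    LinearMap.ext fun a => (nucleus.left_assoc x.1 a (y.1 : A)).symm)

theorem nucBiact_tmul (F A : Type*) [Field F] [NonAssocRing A] [Module F A] [IsScalarTower F A A]
    [SMulCommClass F A A] (K : Subalgebra F (nucleus A)) [IsMulCommutative K] (k k' : K) (a : A) :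
    nucBiact F A K (k ⊗ₜ k') a = ((k : nucleus A) : A) * a * ((k' : nucleus A) : A) :=
  nucleus.left_assoc k.1 a (k'.1 : A) ▸ rfl

/-- `A` is minimally faithful as a module over `K ⊗ K`. -/
def IsMinimallyFaithfulOver (F A : Type*) [Field F] [NonAssocRing A] [Module F A]
    [IsScalarTower F A A] [SMulCommClass F A A] (K : Subalgebra F (nucleus A))
    [IsMulCommutative K] : Prop :=
  letI : Module (K ⊗[F] K) A := Module.compHom A (nucBiact F A K).toRingHom
  IsMinimallyFaithful (K ⊗[F] K) A

/-- A finite dimensional central nonassociative `F`-algebra is semiassociative if it is minimally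
faithful over `K ⊗ K` for some étale `F`-subalgebra `K` of its nucleus. -/
def IsSemiassociative (F A : Type*) [Field F] [NonAssocRing A] [Module F A]
    [IsScalarTower F A A] [SMulCommClass F A A] : Prop :=
  FiniteDimensional F A ∧ IsCentralNonAssoc F A ∧
    ∃ (K : Subalgebra F (nucleus A)) (_ : IsMulCommutative K),
      Algebra.Etale F K ∧ IsMinimallyFaithfulOver F A K

end Semiassociative

section Separable

/-- An associative `F`-algebra `R` is separable if it is projective as a module over
`R ⊗ Rᵐᵒᵖ`, acting by `(r ⊗ r') x = r x r'`. -/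
def IsSeparableAlgebra (F R : Type*) [Field F] [Ring R] [Algebra F R] : Prop :=
  letI : Module (R ⊗[F] Rᵐᵒᵖ) R := TensorProduct.Algebra.module
  Module.Projective (R ⊗[F] Rᵐᵒᵖ) R

end Separable

/-! ### Algebras with one-dimensional Peirce components and a trace form -/

section MonomialSystem

/-! Since `K` is étale, `K ⊗ K` is a product of fields, and a minimally faithful module over it is
free of rank one. Hence `A ≅ K ⊗ K`, and `N = Nuc(A)` embeds into `K ⊗ K` as a `K`-bimodule. Only
this embedding is used afterwards.

Over an algebraic closure `E`, `K` splits, and its primitive idempotents `e i` cut `E ⊗ N` into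
Peirce components of dimension at most one. The separability idempotent of `K` projects `N` onto
`K`; composing with the trace of `K` gives a form `t` on `N`. Computing with lines shows that `t` is
symmetric and that its radical is `Jac(N)` (`form_mul_comm`, `mem_jacobson_iff`). This description
of the radical is compatible with scalar extension.

Section: `Jac(N)` is a sub-bimodule, so some idempotent of `K ⊗ K` acts as a projection `q` onto it.
A Peirce element outside the radical is invertible between its two idempotents; hence `ker q` is
closed under products (`ker_mul_closed`) and is the required complement.

Separability: the section fixes `K`, so `N / Jac(N)` embeds in the same way and one may assume `t`
nondegenerate. Dual bases `b`, `d` give central elements `∑ b k * u * d k`, and it suffices to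
obtain `1`. The choice `u = 1` can fail in positive characteristic (matrices of size divisible by
it); over `E` one takes `u` to be a sum of one `e i` from each block, and solvability of a linear
equation descends to `F`. -/

/-- A complete system of orthogonal idempotents `e` in an `E`-algebra `B` all of whose Peirce
components `e i * B * e j` are at most one dimensional, together with a linear form taking the
value `1` on each `e i` and commuting with the `e i`. -/
structure IsMonomialSystem {E B ι : Type*} [Field E] [Ring B] [Algebra E B] [Fintype ι]
    (e : ι → B) (τ : B →ₗ[E] E) : Prop where
  complete : CompleteOrthogonalIdempotents e
  exists_smul : ∀ (i j : ι) (b c : B), e i * b * e j = b → e i * c * e j = c → c ≠ 0 →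
    ∃ r : E, b = r • c
  form_comm : ∀ i b, τ (e i * b) = τ (b * e i)
  form_idem : ∀ i, τ (e i) = 1

namespace IsMonomialSystem

variable {E B ι : Type*} [Field E] [Ring B] [Algebra E B] [Fintype ι] {e : ι → B}
  {τ : B →ₗ[E] E}

theorem idem_mul (h : IsMonomialSystem e τ) (i : ι) : e i * e i = e i := h.complete.idem i

theorem idem_ne_zero (h : IsMonomialSystem e τ) (i : ι) : e i ≠ 0 := by
  intro h0
  have := h.form_idem i
  simp [h0] at this

theorem peirce_peirce (h : IsMonomialSystem e τ) (i j : ι) (b : B) :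
    e i * (e i * b * e j) * e j = e i * b * e j := by
  simp only [mul_assoc, h.idem_mul]
  rw [← mul_assoc (e i) (e i), h.idem_mul]

theorem idem_mul_peirce (h : IsMonomialSystem e τ) {i j : ι} {b : B} (hb : e i * b * e j = b) :
    e i * b = b := by
  rw [← hb, mul_assoc, ← mul_assoc (e i) (e i), h.idem_mul]

theorem peirce_mul_idem (h : IsMonomialSystem e τ) {i j : ι} {b : B} (hb : e i * b * e j = b) :
    b * e j = b := by
  rw [← hb, mul_assoc, h.idem_mul]

/-- The corner at `e i` is the line spanned by `e i`, and `τ (e i) = 1` identifies the scalar. -/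
theorem corner (h : IsMonomialSystem e τ) (i : ι) (b : B) (hb : e i * b * e i = b) :
    b = τ b • e i := by
  obtain ⟨r, hr⟩ := h.exists_smul i i b (e i) hb (by simp [h.idem_mul]) (h.idem_ne_zero i)
  have : τ b = r := by rw [hr, map_smul, h.form_idem, smul_eq_mul, mul_one]
  rw [this, ← hr]

theorem sum_mul (h : IsMonomialSystem e τ) (b : B) : ∑ i, e i * b = b := by
  rw [← Finset.sum_mul, h.complete.complete, one_mul]

theorem sum_mul_idem (h : IsMonomialSystem e τ) (b : B) : ∑ i, b * e i = b := by
  rw [← Finset.mul_sum, h.complete.complete, mul_one]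

theorem form_mul_eq_sum (h : IsMonomialSystem e τ) (b c : B) :
    τ (b * c) = ∑ i, ∑ j, τ ((e i * b * e j) * (e j * c * e i)) := by
  have key : ∀ i j, τ ((e i * b * e j) * (e j * c * e i)) = τ (e i * b * e j * c) := by
    intro i j
    have e1 : (e i * b * e j) * (e j * c * e i) = (e i * b * e j * c) * e i := by
      simp only [mul_assoc]
      rw [← mul_assoc (e j) (e j), h.idem_mul]
    rw [e1, ← h.form_comm]
    simp only [← mul_assoc, h.idem_mul]
  simp_rw [key, ← map_sum, ← Finset.sum_mul, h.sum_mul_idem, h.sum_mul]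

/-- Both `x * y` and `y * x` are scalars in their corners; evaluating `x * y * x` in two ways shows
that the scalars agree. -/
theorem form_mul_comm_of_peirce (h : IsMonomialSystem e τ) {i j : ι} {x y : B}
    (hx : e i * x * e j = x) (hy : e j * y * e i = y) : τ (x * y) = τ (y * x) := by
  have hxl := h.idem_mul_peirce hx
  have hxr := h.peirce_mul_idem hx
  have hyl := h.idem_mul_peirce hy
  have hyr := h.peirce_mul_idem hy
  have h1 := h.corner i (x * y) (by rw [mul_assoc, mul_assoc, hyr, ← mul_assoc, hxl])
  have h2 := h.corner j (y * x) (by rw [mul_assoc, mul_assoc, hxr, ← mul_assoc, hyl])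
  by_cases hx0 : x = 0
  · simp [hx0]
  · have h3 : τ (x * y) • x = τ (y * x) • x := by
      calc τ (x * y) • x = (τ (x * y) • e i) * x := by rw [smul_mul_assoc, hxl]
        _ = x * y * x := by rw [← h1]
        _ = x * (τ (y * x) • e j) := by rw [← h2, mul_assoc]
        _ = _ := by rw [mul_smul_comm, hxr]
    exact smul_left_injective E hx0 h3

theorem form_mul_comm (h : IsMonomialSystem e τ) (b c : B) : τ (b * c) = τ (c * b) := by
  rw [h.form_mul_eq_sum b c, h.form_mul_eq_sum c b, Finset.sum_comm]
  refine Finset.sum_congr rfl fun j _ => Finset.sum_congr rfl fun i _ => ?_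
  exact h.form_mul_comm_of_peirce (h.peirce_peirce i j b) (h.peirce_peirce j i c)

theorem radical_le_jacobson (h : IsMonomialSystem e τ) {b : B} (hb : ∀ c, τ (b * c) = 0) :
    b ∈ Ring.jacobson B := by
  rw [Ring.jacobson_eq_sInf_isMaximal, Ideal.mem_sInf]
  intro m hm
  have hm : m.IsMaximal := hm
  -- Otherwise `y * (b * e i) + z = 1` with `z ∈ m`. The corner element `e i * y * b * e i` has form
  -- value `τ (b * (e i * y)) = 0`, so it vanishes; then `e i = e i * z ∈ m`, a contradiction.
  have hmem : ∀ i, b * e i ∈ m := by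
    intro i
    by_contra hbi
    have hei : e i ∉ m := fun hc => hbi (m.mul_mem_left b hc)
    obtain ⟨y, hy⟩ := hm.exists_inv hbi
    obtain ⟨z, hz, hyz⟩ := hy
    apply hei
    have h0 : e i * (e i * y * b) * e i = 0 := by
      have hp := h.corner i (e i * (e i * y * b) * e i) (h.peirce_peirce i i _)
      rw [hp, ← h.form_comm]
      have : e i * (e i * (e i * y * b)) = (e i * y) * b := by
        simp only [← mul_assoc, h.idem_mul]
      rw [this, h.form_mul_comm, hb, zero_smul]
    have h1 : e i * (y * (b * e i)) = 0 := by
      simpa only [← mul_assoc, h.idem_mul] using h0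
    have h2 : e i = e i * z := by
      calc e i = e i * (y * (b * e i) + z) := by rw [hyz, mul_one]
        _ = e i * z := by rw [mul_add, h1, zero_add]
    rw [h2]
    exact m.mul_mem_left _ hz
  rw [← h.sum_mul_idem b]
  exact Submodule.sum_mem _ fun i _ => hmem i

/-- The component `y = e j * c * e i` satisfies `b * y = τ (b * c) • e i` and `y * b = τ (b * c) • e
j`, so rescaling `y` gives the inverse. -/
theorem exists_inverse (h : IsMonomialSystem e τ) {i j : ι} {b : B} (hb : e i * b * e j = b)
    (hne : ∃ c, τ (b * c) ≠ 0) : ∃ b', e j * b' * e i = b' ∧ b' * b = e j ∧ b * b' = e i := by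
  obtain ⟨c, hc⟩ := hne
  have hbl := h.idem_mul_peirce hb
  have hbr := h.peirce_mul_idem hb
  set y := e j * c * e i with hy
  have hyy : e j * y * e i = y := h.peirce_peirce j i c
  have hyl := h.idem_mul_peirce hyy
  have hyr := h.peirce_mul_idem hyy
  have h1 := h.corner i (b * y) (by rw [mul_assoc, mul_assoc, hyr, ← mul_assoc, hbl])
  have h2 := h.corner j (y * b) (by rw [mul_assoc, mul_assoc, hbr, ← mul_assoc, hyl])
  have h3 : τ (b * y) = τ (b * c) := by
    rw [hy, mul_assoc, ← mul_assoc b, hbr, ← mul_assoc, ← h.form_comm, ← mul_assoc, hbl]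
  have h4 := h.form_mul_comm b y
  rw [h3] at h1 h4
  rw [← h4] at h2
  refine ⟨(τ (b * c))⁻¹ • y, ?_, ?_, ?_⟩
  · rw [mul_smul_comm, smul_mul_assoc, hyy]
  · rw [smul_mul_assoc, h2, smul_smul, inv_mul_cancel₀ hc, one_smul]
  · rw [mul_smul_comm, h1, smul_smul, inv_mul_cancel₀ hc, one_smul]

/-- The kernel of a projection onto the radical of the trace form which commutes with
multiplication by the idempotents is multiplicatively closed. -/
theorem ker_mul_closed (h : IsMonomialSystem e τ) (q : B →ₗ[E] B)
    (hl : ∀ i b, q (e i * b) = e i * q b) (hr : ∀ i b, q (b * e i) = q b * e i)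
    (hq : ∀ b c, τ (q b * c) = 0) (hid : ∀ b, (∀ c, τ (b * c) = 0) → q b = b)
    {b c : B} (hb : q b = 0) (hc : q c = 0) : q (b * c) = 0 := by
  have key : ∀ i j k, q ((e i * b * e j) * (e j * c * e k)) = 0 := by
    intro i j k
    have hqx : q (e i * b * e j) = 0 := by rw [hr, hl, hb]; simp
    have hqy : q (e j * c * e k) = 0 := by rw [hr, hl, hc]; simp
    have hx := h.peirce_peirce i j b
    have hy := h.peirce_peirce j k c
    generalize e i * b * e j = x at *
    generalize e j * c * e k = y at *
    have hxl := h.idem_mul_peirce hx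
    have hyr := h.peirce_mul_idem hy
    have hyl := h.idem_mul_peirce hy
    -- If `q (x * y) ≠ 0`, then `x * y` is a multiple of it and lies in the radical. Since `x` is
    -- not in the radical (else `x = q x = 0`), it has an inverse `x'`; then `y = x' * (x * y)` is
    -- in the radical, so `y = q y = 0`.
    by_contra hne
    obtain ⟨r, hrr⟩ := h.exists_smul i k (x * y) (q (x * y))
      (by rw [mul_assoc, mul_assoc, hyr, ← mul_assoc, hxl])
      (by rw [← hl, ← hr, mul_assoc, mul_assoc, hyr, ← mul_assoc, hxl]) hne
    have hrad : ∀ d, τ (x * y * d) = 0 := by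
      intro d
      rw [hrr, smul_mul_assoc, map_smul, hq, smul_zero]
    have hxne : ∃ d, τ (x * d) ≠ 0 := by
      by_contra! hx0
      apply hne
      rw [← hid x hx0, hqx, zero_mul, map_zero]
    obtain ⟨x', -, hx', -⟩ := h.exists_inverse hx hxne
    have hy0 : q y = y := hid y fun d => by
      have : y * d = x' * (x * y * d) := by
        rw [← mul_assoc, ← mul_assoc, hx', hyl]
      rw [this, h.form_mul_comm, mul_assoc, hrad]
    apply hne
    rw [← hy0, hqy, mul_zero, map_zero]
  have hsum : b * c = ∑ i, ∑ j, ∑ k, (e i * b * e j) * (e j * c * e k) := by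
    have hj : ∀ i j, e i * b * e j * (e j * c) = e i * b * e j * c := fun i j => by
      rw [← mul_assoc, mul_assoc _ (e j) (e j), h.idem_mul]
    simp_rw [← Finset.mul_sum, h.complete.complete, mul_one, hj, ← Finset.sum_mul,
      ← Finset.mul_sum, h.complete.complete, mul_one, h.sum_mul]
  rw [hsum]
  simp only [map_sum, key, Finset.sum_const_zero]

open Classical in
theorem trace_peirce (h : IsMonomialSystem e τ) [FiniteDimensional E B] (i j : ι) :
    LinearMap.trace E B (LinearMap.mulLeft E (e i) ∘ₗ LinearMap.mulRight E (e j)) =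
      if ∃ b, e i * b * e j ≠ 0 then 1 else 0 := by
  split_ifs with hex
  · obtain ⟨b, hb⟩ := hex
    have hproj : LinearMap.IsProj (Submodule.span E {e i * b * e j})
        (LinearMap.mulLeft E (e i) ∘ₗ LinearMap.mulRight E (e j)) := by
      constructor
      · intro x
        obtain ⟨r, hr⟩ := h.exists_smul i j (e i * x * e j) (e i * b * e j)
          (h.peirce_peirce i j x) (h.peirce_peirce i j b) hb
        rw [Submodule.mem_span_singleton]
        exact ⟨r, by rw [← hr]; simp [mul_assoc]⟩
      · intro x hx
        obtain ⟨r, rfl⟩ := Submodule.mem_span_singleton.1 hx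
        rw [map_smul]
        congr 1
        simpa [mul_assoc] using h.peirce_peirce i j b
    rw [hproj.trace, finrank_span_singleton hb, Nat.cast_one]
  · push Not at hex
    have : LinearMap.mulLeft E (e i) ∘ₗ LinearMap.mulRight E (e j) = 0 := by
      ext x
      simpa [mul_assoc] using hex x
    rw [this, map_zero]

/-- If the trace form is nondegenerate, having a nonzero Peirce component is an equivalence
relation on the idempotents. -/
theorem equivalence_of_nondegenerate (h : IsMonomialSystem e τ)
    (hnd : ∀ b, (∀ c, τ (b * c) = 0) → b = 0) :
    Equivalence fun i j => ∃ b, e i * b * e j ≠ 0 := by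
  have hinv : ∀ {i j b}, e i * b * e j ≠ 0 → ∃ c, τ (e i * b * e j * c) ≠ 0 := by
    intro i j b hb
    by_contra! hc
    exact hb (hnd _ hc)
  refine ⟨fun i => ⟨1, by simpa [h.idem_mul] using h.idem_ne_zero i⟩, ?_, ?_⟩
  · rintro i j ⟨b, hb⟩
    obtain ⟨b', h1, h2, h3⟩ := h.exists_inverse (h.peirce_peirce i j b) (hinv hb)
    refine ⟨b', fun h0 => h.idem_ne_zero i ?_⟩
    rw [← h3, ← h1, h0, mul_zero]
  · rintro i j k ⟨b, hb⟩ ⟨c, hc⟩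
    obtain ⟨b', h1, h2, h3⟩ := h.exists_inverse (h.peirce_peirce i j b) (hinv hb)
    refine ⟨b * e j * c, fun h0 => hc ?_⟩
    calc e j * c * e k = (b' * (e i * b * e j)) * c * e k := by rw [h2]
      _ = b' * (e i * (b * e j * c) * e k) := by simp only [mul_assoc]
      _ = 0 := by rw [h0, mul_zero]

theorem exists_trace_eq_one (h : IsMonomialSystem e τ) [FiniteDimensional E B]
    (hnd : ∀ b, (∀ c, τ (b * c) = 0) → b = 0) :
    ∃ w : B, ∀ j,
      LinearMap.trace E B (LinearMap.mulLeft E w ∘ₗ LinearMap.mulRight E (e j)) = 1 := by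
  classical
  let r : Setoid ι := ⟨_, h.equivalence_of_nondegenerate hnd⟩
  -- One representative per class: exactly one chosen `e i` has a nonzero component towards `e j`,
  -- and it contributes trace `1`.
  refine ⟨∑ i with (Quotient.mk r i).out = i, e i, fun j => ?_⟩
  have hlin : LinearMap.mulLeft E (∑ i with (Quotient.mk r i).out = i, e i) ∘ₗ
      LinearMap.mulRight E (e j) = ∑ i with (Quotient.mk r i).out = i,
        LinearMap.mulLeft E (e i) ∘ₗ LinearMap.mulRight E (e j) := by
    ext x
    simp [Finset.sum_mul]
  rw [hlin, map_sum]
  simp_rw [h.trace_peirce]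
  rw [Finset.sum_eq_single (Quotient.mk r j).out]
  · exact if_pos (Quotient.mk_out (s := r) j)
  · intro i hi hij
    rw [if_neg]
    intro hex
    apply hij
    have : Quotient.mk r i = Quotient.mk r j := Quotient.sound (s := r) hex
    rw [← this]
    exact (Finset.mem_filter.1 hi).2.symm
  · intro hj
    exact absurd (by simp) hj

end IsMonomialSystem

end MonomialSystem

/-! ### Algebras embedded in `K ⊗ K` as bimodules, and the form they carry -/

section BimoduleEmbedding

variable {F N K : Type*} [Field F] [Ring N] [Algebra F N] [CommRing K] [Algebra F K]

/-- The action `(k ⊗ k') x = k x k'` of `K ⊗ K` on an algebra over which `K` maps. -/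
noncomputable def bimoduleAct (i : K →ₐ[F] N) : K ⊗[F] K →ₐ[F] Module.End F N :=
  Algebra.TensorProduct.lift ((Algebra.lmul F N).comp i)
    (AlgHom.ofLinearMap ((LinearMap.mul F N).flip ∘ₗ i.toLinearMap)
      (LinearMap.ext fun x => by simp)
      (fun x y => LinearMap.ext fun a => by
        rw [mul_comm x y]
        simp [mul_assoc]))
    (fun x y => LinearMap.ext fun a => by simp [mul_assoc])

@[simp]
theorem bimoduleAct_tmul (i : K →ₐ[F] N) (k k' : K) (x : N) :
    bimoduleAct i (k ⊗ₜ k') x = i k * x * i k' := by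
  rw [mul_assoc]
  rfl

theorem bimoduleAct_mul_left (i : K →ₐ[F] N) (z : K ⊗[F] K) (k : K) (x : N) :
    bimoduleAct i z (i k * x) = i k * bimoduleAct i z x := by
  have h : ∀ y, i k * y = bimoduleAct i (k ⊗ₜ 1) y := fun y => by simp
  rw [h, h, ← Module.End.mul_apply, ← Module.End.mul_apply, ← map_mul, ← map_mul, mul_comm]

theorem bimoduleAct_mul_right (i : K →ₐ[F] N) (z : K ⊗[F] K) (k : K) (x : N) :
    bimoduleAct i z (x * i k) = bimoduleAct i z x * i k := by
  have h : ∀ y, y * i k = bimoduleAct i (1 ⊗ₜ k) y := fun y => by simp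
  rw [h, h, ← Module.End.mul_apply, ← Module.End.mul_apply, ← map_mul, ← map_mul, mul_comm]

theorem bimoduleAct_one (i : K →ₐ[F] N) (z : K ⊗[F] K) (k : K) :
    bimoduleAct i z (i k) = i (Algebra.TensorProduct.lmul' F z * k) := by
  induction z with
  | zero => simp
  | tmul a b => rw [bimoduleAct_tmul, Algebra.TensorProduct.lmul'_apply_tmul, ← map_mul, ← map_mul,
      mul_right_comm]
  | add a b ha hb => rw [map_add, LinearMap.add_apply, ha, hb, map_add, add_mul, map_add]

theorem bimoduleAct_mem (i : K →ₐ[F] N) (I : Ideal N) [I.IsTwoSided] (z : K ⊗[F] K) {x : N}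
    (hx : x ∈ I) : bimoduleAct i z x ∈ I := by
  induction z with
  | zero => simp
  | tmul a b =>
    rw [bimoduleAct_tmul]
    exact I.mul_mem_right _ (I.mul_mem_left _ hx)
  | add a b ha hb =>
    rw [map_add, LinearMap.add_apply]
    exact I.add_mem ha hb

/-- An injective homomorphism `i : K → N` together with an injective map of `K`-bimodules
`θ : N → K ⊗ K`. -/
structure IsBimoduleEmbedding (i : K →ₐ[F] N) (θ : N →ₗ[F] K ⊗[F] K) : Prop where
  inj_hom : Function.Injective i
  inj_map : Function.Injective θ
  map_mul_mul : ∀ k k' x, θ (i k * x * i k') = (k ⊗ₜ k') * θ x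

namespace IsBimoduleEmbedding

variable {i : K →ₐ[F] N} {θ : N →ₗ[F] K ⊗[F] K}

theorem map_act (h : IsBimoduleEmbedding i θ) (z : K ⊗[F] K) (x : N) :
    θ (bimoduleAct i z x) = z * θ x := by
  induction z with
  | zero => simp
  | tmul a b => rw [bimoduleAct_tmul, h.map_mul_mul]
  | add a b ha hb => rw [map_add, LinearMap.add_apply, map_add, ha, hb, add_mul]

variable [Algebra.Etale F K]

open Algebra.FormallyUnramified in
theorem range_act_elem (h : IsBimoduleEmbedding i θ) :
    LinearMap.range (bimoduleAct i (elem F K)) = LinearMap.range i.toLinearMap := by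
  have hfin : Module.Finite F K := finite_of_free F K
  have hN : Module.Finite F N := Module.Finite.of_injective θ h.inj_map
  symm
  apply Submodule.eq_of_le_of_finrank_le
  · rintro _ ⟨k, rfl⟩
    exact ⟨i k, by rw [bimoduleAct_one, lmul_elem, one_mul]; rfl⟩
  · let f : K →ₗ[F] K ⊗[F] K :=
      LinearMap.mulRight F (elem F K) ∘ₗ (Algebra.TensorProduct.includeLeft).toLinearMap
    -- Because `(1 ⊗ b) * elem = (b ⊗ 1) * elem`, the ideal generated by `elem` has dimension at
    -- most that of `K`; through `θ` this bounds the range.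
    have hz : ∀ z : K ⊗[F] K, z * elem F K ∈ LinearMap.range f := by
      intro z
      induction z with
      | zero => simp
      | tmul a b =>
        refine ⟨a * b, ?_⟩
        change ((a * b) ⊗ₜ 1) * elem F K = _
        have h1 : (a ⊗ₜ[F] b : K ⊗[F] K) = (a ⊗ₜ 1) * (1 ⊗ₜ b) := by simp
        have h2 : ((a * b) ⊗ₜ[F] (1 : K) : K ⊗[F] K) = (a ⊗ₜ 1) * (b ⊗ₜ 1) := by simp
        rw [h1, h2, mul_assoc, mul_assoc, one_tmul_mul_elem]
      | add a b ha hb =>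
        rw [add_mul]
        exact Submodule.add_mem _ ha hb
    have hle : (LinearMap.range (bimoduleAct i (elem F K))).map θ ≤ LinearMap.range f := by
      rintro _ ⟨_, ⟨x, rfl⟩, rfl⟩
      rw [h.map_act, mul_comm]
      exact hz _
    calc Module.finrank F (LinearMap.range (bimoduleAct i (elem F K)))
        = Module.finrank F ((LinearMap.range (bimoduleAct i (elem F K))).map θ) :=
          (LinearEquiv.finrank_eq (Submodule.equivMapOfInjective θ h.inj_map _))
      _ ≤ Module.finrank F (LinearMap.range f) := Submodule.finrank_mono hle
      _ ≤ Module.finrank F K := LinearMap.finrank_range_le f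
      _ = _ := (LinearMap.finrank_range_of_inj h.inj_hom).symm

open Algebra.FormallyUnramified in
theorem exists_retraction (h : IsBimoduleEmbedding i θ) :
    ∃ π : N →ₗ[F] K, ∀ x, i (π x) = bimoduleAct i (elem F K) x := by
  let f := LinearEquiv.ofInjective i.toLinearMap h.inj_hom
  refine ⟨f.symm.toLinearMap ∘ₗ (LinearMap.codRestrict (LinearMap.range i.toLinearMap)
    (bimoduleAct i (elem F K)) fun x => ?_), fun x => ?_⟩
  · rw [← h.range_act_elem]
    exact ⟨x, rfl⟩
  · exact congrArg Subtype.val (f.apply_symm_apply _)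

open Algebra.FormallyUnramified in
/-- The linear form obtained by composing the projection of `N` onto `K` with the trace of `K`. -/
theorem exists_form (h : IsBimoduleEmbedding i θ) :
    ∃ t : N →ₗ[F] F, (∀ k x, t (i k * x) = t (x * i k)) ∧
      (∀ k, t (i k) = Algebra.trace F K k) ∧ ∀ x ∈ Ring.jacobson N, t x = 0 := by
  have hfin : Module.Finite F K := finite_of_free F K
  have hN : Module.Finite F N := Module.Finite.of_injective θ h.inj_map
  have hred := isReduced_of_field F K
  obtain ⟨π, hπ⟩ := h.exists_retraction
  refine ⟨Algebra.trace F K ∘ₗ π, fun k x => ?_, fun k => ?_, fun x hx => ?_⟩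
  · have : π (i k * x) = π (x * i k) := by
      apply h.inj_hom
      rw [hπ, hπ, bimoduleAct_mul_left, bimoduleAct_mul_right, ← hπ, ← map_mul, ← map_mul,
        mul_comm]
    simp [this]
  · have : π (i k) = k := by
      apply h.inj_hom
      rw [hπ, bimoduleAct_one, lmul_elem, one_mul]
    simp [this]
  -- The projection preserves the nilpotent ideal `Jac(N)`, and `K` is reduced, so `π x = 0`.
  · have hmem : i (π x) ∈ Ring.jacobson N := by
      rw [hπ]
      exact bimoduleAct_mem i _ _ hx
    have : IsArtinianRing N := IsArtinianRing.of_finite F N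
    obtain ⟨n, hn⟩ := IsSemiprimaryRing.isNilpotent (R := N)
    have hnil : π x = 0 := by
      apply IsReduced.eq_zero
      refine ⟨n, h.inj_hom ?_⟩
      have := Ideal.pow_mem_pow hmem n
      rw [hn] at this
      rw [map_pow, map_zero]
      simpa using this
    simp [hnil]

end IsBimoduleEmbedding

end BimoduleEmbedding

/-! ### Scalar extension and splitting of `K` -/

section BaseChange

universe u v

variable {F N : Type*} {K : Type u} [Field F] [Ring N] [Algebra F N] [CommRing K] [Algebra F K]
variable (E : Type v) [Field E] [Algebra F E]

/-- The base change of a linear form. -/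
noncomputable def baseChangeForm (t : N →ₗ[F] F) : E ⊗[F] N →ₗ[E] E :=
  (TensorProduct.AlgebraTensorModule.rid F E E).toLinearMap ∘ₗ t.baseChange E

@[simp]
theorem baseChangeForm_tmul (t : N →ₗ[F] F) (a : E) (x : N) :
    baseChangeForm E t (a ⊗ₜ x) = t x • a := by
  simp [baseChangeForm]

variable {i : K →ₐ[F] N} {θ : N →ₗ[F] K ⊗[F] K}

theorem baseChangeForm_map (t : N →ₗ[F] F) (ht : ∀ k, t (i k) = Algebra.trace F K k)
    [Module.Finite F K] (x : E ⊗[F] K) :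
    baseChangeForm E t (Algebra.TensorProduct.map (AlgHom.id E E) i x) =
      Algebra.trace E (E ⊗[F] K) x := by
  induction x with
  | zero => simp
  | tmul a k =>
    have h1 : (a ⊗ₜ[F] k : E ⊗[F] K) = a • ((1 : E) ⊗ₜ k) := by
      rw [TensorProduct.smul_tmul', smul_eq_mul, mul_one]
    have h2 : Algebra.lmul E (E ⊗[F] K) (1 ⊗ₜ k) = (Algebra.lmul F K k).baseChange E := by
      ext; simp
    rw [Algebra.TensorProduct.map_tmul, baseChangeForm_tmul, ht, h1, map_smul,
      Algebra.trace_apply E, h2, LinearMap.trace_baseChange, ← Algebra.trace_apply]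
    simp [Algebra.smul_def, mul_comm]
  | add x y hx hy => simp only [map_add, hx, hy]

theorem baseChangeForm_mul_comm (t : N →ₗ[F] F) (ht : ∀ k x, t (i k * x) = t (x * i k))
    (x : E ⊗[F] K) (b : E ⊗[F] N) :
    baseChangeForm E t (Algebra.TensorProduct.map (AlgHom.id E E) i x * b) =
      baseChangeForm E t (b * Algebra.TensorProduct.map (AlgHom.id E E) i x) := by
  induction x with
  | zero => simp
  | add x y hx hy => simp only [map_add, add_mul, mul_add, hx, hy]
  | tmul a k =>
    induction b with
    | zero => simp
    | add x y hx hy => simp only [map_add, add_mul, mul_add, hx, hy]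
    | tmul c y => simp [ht, mul_comm]

theorem baseChange_map_mul_mul (hθ : ∀ k k' x, θ (i k * x * i k') = (k ⊗ₜ k') * θ x)
    (x y : E ⊗[F] K) (b : E ⊗[F] N) :
    θ.baseChange E (Algebra.TensorProduct.map (AlgHom.id E E) i x * b *
        Algebra.TensorProduct.map (AlgHom.id E E) i y) =
      Algebra.TensorProduct.map (AlgHom.id E E) Algebra.TensorProduct.includeLeft x *
      Algebra.TensorProduct.map (AlgHom.id E E) Algebra.TensorProduct.includeRight y *
        θ.baseChange E b := by
  induction x with
  | zero => simp
  | add x y hx hy => simp only [map_add, add_mul, hx, hy]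
  | tmul a k =>
    induction y with
    | zero => simp
    | add x y hx hy => simp only [map_add, add_mul, mul_add, hx, hy]
    | tmul a' k' =>
      induction b with
      | zero => simp
      | add x y hx hy => simp only [map_add, add_mul, mul_add, hx, hy]
      | tmul c y => simp [hθ, mul_right_comm]

theorem baseChange_act_mul (z : K ⊗[F] K) (x : E ⊗[F] K) (b : E ⊗[F] N) :
    (bimoduleAct i z).baseChange E (Algebra.TensorProduct.map (AlgHom.id E E) i x * b) =
      Algebra.TensorProduct.map (AlgHom.id E E) i x * (bimoduleAct i z).baseChange E b := by
  induction x with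
  | zero => simp
  | add x y hx hy => simp only [map_add, add_mul, hx, hy]
  | tmul a k =>
    induction b with
    | zero => simp
    | add x y hx hy => simp only [map_add, mul_add, hx, hy]
    | tmul c y => simp [bimoduleAct_mul_left]

theorem baseChange_act_mul_right (z : K ⊗[F] K) (x : E ⊗[F] K) (b : E ⊗[F] N) :
    (bimoduleAct i z).baseChange E (b * Algebra.TensorProduct.map (AlgHom.id E E) i x) =
      (bimoduleAct i z).baseChange E b * Algebra.TensorProduct.map (AlgHom.id E E) i x := by
  induction x with
  | zero => simp
  | add x y hx hy => simp only [map_add, mul_add, hx, hy]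
  | tmul a k =>
    induction b with
    | zero => simp
    | add x y hx hy => simp only [map_add, add_mul, hx, hy]
    | tmul c y => simp [bimoduleAct_mul_right]

/-- An element of the radical of the base change of a trace form is a combination of elements
of the radical. -/
theorem mem_radical_baseChangeForm {t : N →ₗ[F] F} {b : E ⊗[F] N}
    (hb : ∀ c, baseChangeForm E t (b * c) = 0) :
    b ∈ Submodule.span E {y | ∃ x : N, (∀ y, t (x * y) = 0) ∧ (1 : E) ⊗ₜ[F] x = y} := by
  classical
  let ℬ := Module.Basis.ofVectorSpace F E
  obtain ⟨c, rfl⟩ := (TensorProduct.equivFinsuppOfBasisLeft (N := N) ℬ).symm.surjective b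
  rw [TensorProduct.equivFinsuppOfBasisLeft_symm_apply] at hb ⊢
  refine Submodule.sum_mem _ fun j _ => ?_
  have h1 : (ℬ j ⊗ₜ[F] c j : E ⊗[F] N) = ℬ j • ((1 : E) ⊗ₜ c j) := by
    rw [TensorProduct.smul_tmul', smul_eq_mul, mul_one]
  change ℬ j ⊗ₜ[F] c j ∈ _
  rw [h1]
  refine Submodule.smul_mem _ _ (Submodule.subset_span ⟨c j, fun y => ?_, rfl⟩)
  -- Testing against `1 ⊗ y` gives an `F`-linear relation among basis vectors of `E`, so every
  -- coefficient `t (c j * y)` vanishes.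
  have hy := hb (1 ⊗ₜ y)
  rw [Finsupp.sum, Finset.sum_mul, map_sum] at hy
  simp only [Algebra.TensorProduct.tmul_mul_tmul, mul_one, baseChangeForm_tmul] at hy
  by_cases hj : j ∈ c.support
  · exact linearIndependent_iff'.1 ℬ.linearIndependent c.support (fun j => t (c j * y)) hy j hj
  · simp [Finsupp.notMem_support_iff.1 hj]

variable [IsSepClosed E] [Algebra.Etale F K]

/-- `E ⊗ K` is a power of `E`; the system consists of the images of its primitive idempotents, each
of trace `1`. The embedding sends a Peirce component into the part of `E ⊗ (K ⊗ K)` cut out by two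
primitive idempotents, which is spanned by their product. -/
theorem IsBimoduleEmbedding.exists_isMonomialSystem (h : IsBimoduleEmbedding i θ)
    {t : N →ₗ[F] F} (ht : ∀ k x, t (i k * x) = t (x * i k))
    (ht' : ∀ k, t (i k) = Algebra.trace F K k) :
    ∃ (ι : Type (max u v)) (_ : Fintype ι) (c : ι → E ⊗[F] K),
      IsMonomialSystem (fun j => Algebra.TensorProduct.map (AlgHom.id E E) i (c j))
        (baseChangeForm E t) := by
  classical
  have hfin : Module.Finite F K := Algebra.FormallyUnramified.finite_of_free F K
  have : IsArtinianRing (E ⊗[F] K) := IsArtinianRing.of_finite E _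
  let φ := Algebra.FormallyEtale.equivPiOfIsSepClosed E (E ⊗[F] K)
  have : Finite (PrimeSpectrum (E ⊗[F] K)) := inferInstance
  let _ : Fintype (PrimeSpectrum (E ⊗[F] K)) := Fintype.ofFinite _
  let c : PrimeSpectrum (E ⊗[F] K) → E ⊗[F] K := fun p => φ.symm (Pi.single p 1)
  have hc : CompleteOrthogonalIdempotents c :=
    (CompleteOrthogonalIdempotents.single (fun _ : PrimeSpectrum (E ⊗[F] K) => E)).map
      φ.symm.toRingEquiv.toRingHom
  refine ⟨_, _, c, hc.map (Algebra.TensorProduct.map (AlgHom.id E E) i).toRingHom, ?_,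
    fun j b => baseChangeForm_mul_comm E t ht _ _, fun j => ?_⟩
  · have hcc : ∀ p (x : E ⊗[F] K), c p * x = φ x p • c p := by
      intro p x
      apply φ.injective
      ext p'
      by_cases hp : p' = p
      · subst hp; simp [c]
      · simp [c, hp]
    set l : E ⊗[F] K →ₐ[E] E ⊗[F] (K ⊗[F] K) :=
      Algebra.TensorProduct.map (AlgHom.id E E) Algebra.TensorProduct.includeLeft with hl
    set r : E ⊗[F] K →ₐ[E] E ⊗[F] (K ⊗[F] K) :=
      Algebra.TensorProduct.map (AlgHom.id E E) Algebra.TensorProduct.includeRight with hr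
    have hone : ∀ (p p') (z : E ⊗[F] (K ⊗[F] K)), ∃ s : E, l (c p) * r (c p') * z =
        s • (l (c p) * r (c p')) := by
      intro p p' z
      induction z with
      | zero => exact ⟨0, by simp⟩
      | add x y hx hy =>
        obtain ⟨s, hs⟩ := hx
        obtain ⟨s', hs'⟩ := hy
        exact ⟨s + s', by rw [mul_add, hs, hs', add_smul]⟩
      | tmul a z =>
        induction z with
        | zero => exact ⟨0, by simp⟩
        | add x y hx hy =>
          obtain ⟨s, hs⟩ := hx
          obtain ⟨s', hs'⟩ := hy
          exact ⟨s + s', by rw [TensorProduct.tmul_add, mul_add, hs, hs', add_smul]⟩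
        | tmul k k' =>
          have h1 : (a ⊗ₜ[F] (k ⊗ₜ[F] k') : E ⊗[F] (K ⊗[F] K)) = l (a ⊗ₜ k) * r (1 ⊗ₜ k') := by
            simp [hl, hr]
          refine ⟨φ (a ⊗ₜ k) p * φ (1 ⊗ₜ k') p', ?_⟩
          rw [h1, mul_mul_mul_comm, ← map_mul, ← map_mul, hcc, hcc, map_smul, map_smul,
            smul_mul_smul_comm]
    have hinj : Function.Injective (θ.baseChange E) :=
      Module.Flat.lTensor_preserves_injective_linearMap (M := E) θ h.inj_map
    intro p p' b b' hb hb' hne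
    have hθb := baseChange_map_mul_mul E h.map_mul_mul (c p) (c p') b
    have hθb' := baseChange_map_mul_mul E h.map_mul_mul (c p) (c p') b'
    rw [hb] at hθb
    rw [hb'] at hθb'
    obtain ⟨s, hs⟩ := hone p p' (θ.baseChange E b)
    obtain ⟨s', hs'⟩ := hone p p' (θ.baseChange E b')
    rw [hs] at hθb
    rw [hs'] at hθb'
    have hs0 : s' ≠ 0 := by
      rintro rfl
      apply hne
      apply hinj
      rw [hθb', zero_smul, map_zero]
    refine ⟨s / s', hinj ?_⟩
    rw [map_smul, hθb, hθb', smul_smul, div_mul_cancel₀ _ hs0]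
  · rw [baseChangeForm_map E t ht', ← Algebra.trace_eq_of_algEquiv φ,
      Algebra.trace_eq_matrix_trace (Pi.basisFun E _)]
    simp [c, Matrix.trace, Algebra.leftMulMatrix_eq_repr_mul, Pi.single_apply]

end BaseChange

/-- Every ideal of a commutative semisimple ring is generated by an idempotent. -/
theorem Ideal.exists_mem_forall_mul_eq {T : Type*} [CommRing T] [IsSemisimpleRing T]
    (I : Ideal T) : ∃ g ∈ I, ∀ x ∈ I, g * x = x := by
  obtain ⟨I', hI⟩ := exists_isCompl I
  obtain ⟨g, hg, g', hg', hsum⟩ := Submodule.mem_sup.1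
    (hI.sup_eq_top ▸ Submodule.mem_top : (1 : T) ∈ I ⊔ I')
  refine ⟨g, hg, fun x hx => ?_⟩
  have h0 : g' * x = 0 := by
    have : g' * x ∈ I ⊓ I' := ⟨I.mul_mem_left _ hx, I'.mul_mem_right _ hg'⟩
    rwa [hI.inf_eq_bot] at this
  rw [← add_zero (g * x), ← h0, ← add_mul, hsum, one_mul]

theorem isSemisimpleRing_of_etale (F T : Type*) [Field F] [CommRing T] [Algebra F T]
    [Algebra.Etale F T] : IsSemisimpleRing T := by
  have := Algebra.FormallyUnramified.finite_of_free F T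
  have : IsArtinianRing T := IsArtinianRing.of_finite F T
  have := Algebra.FormallyUnramified.isReduced_of_field F T
  exact IsArtinianRing.isSemisimpleRing_of_isReduced T

theorem isSemisimpleRing_tensorProduct_of_etale (F K : Type*) [Field F] [CommRing K] [Algebra F K]
    [Algebra.Etale F K] : IsSemisimpleRing (K ⊗[F] K) := by
  have : Algebra.Etale F (K ⊗[F] K) := Algebra.Etale.comp F K (K ⊗[F] K)
  exact isSemisimpleRing_of_etale F (K ⊗[F] K)

/-! ### Separability elements -/

section Separable

variable {F R : Type*} [Field F] [Ring R] [Algebra F R]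

/-- A separability element makes the multiplication map split. -/
theorem isSeparableAlgebra_of_element (p : R ⊗[F] Rᵐᵒᵖ)
    (hp : ∀ r : R, (r ⊗ₜ 1) * p = (1 ⊗ₜ MulOpposite.op r) * p)
    (hp1 : TensorProduct.Algebra.moduleAux p (1 : R) = 1) : IsSeparableAlgebra F R := by
  have haux : ∀ a b r : R,
      TensorProduct.Algebra.moduleAux (a ⊗ₜ[F] MulOpposite.op b) r = a * r * b := fun a b r => by
    rw [TensorProduct.Algebra.moduleAux_apply]
    simp [mul_assoc]
  have hlin : ∀ (z : R ⊗[F] Rᵐᵒᵖ) (r : R),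
      (TensorProduct.Algebra.moduleAux z r ⊗ₜ[F] (1 : Rᵐᵒᵖ)) * p = z * ((r ⊗ₜ 1) * p) := by
    intro z r
    induction z with
    | zero => simp
    | add x y hx hy =>
      rw [map_add, LinearMap.add_apply, TensorProduct.add_tmul, add_mul, hx, hy, add_mul]
    | tmul a b =>
      obtain ⟨b, rfl⟩ := MulOpposite.op_surjective b
      have h1 : ((a * r * b) ⊗ₜ[F] (1 : Rᵐᵒᵖ) : R ⊗[F] Rᵐᵒᵖ) = ((a * r) ⊗ₜ 1) * (b ⊗ₜ 1) := by
        simp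
      rw [haux, h1, mul_assoc, hp, ← mul_assoc, ← mul_assoc]
      simp
  unfold IsSeparableAlgebra
  let _ : Module (R ⊗[F] Rᵐᵒᵖ) R := TensorProduct.Algebra.module
  let f : R →ₗ[R ⊗[F] Rᵐᵒᵖ] R ⊗[F] Rᵐᵒᵖ :=
    { toFun := fun r => (r ⊗ₜ 1) * p
      map_add' := fun x y => by rw [TensorProduct.add_tmul, add_mul]
      map_smul' := hlin }
  refine Module.Projective.of_split f (LinearMap.toSpanSingleton _ R (1 : R)) ?_
  refine LinearMap.ext fun r => ?_
  change ((r ⊗ₜ[F] (1 : Rᵐᵒᵖ)) * p) • (1 : R) = r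
  have h2 : p • (1 : R) = 1 := hp1
  have h3 : (r ⊗ₜ[F] (1 : Rᵐᵒᵖ)) • (1 : R) = r := (haux r 1 1).trans (by simp)
  rw [mul_smul, h2, h3]

end Separable

/-! ### Casimir operators of a symmetric form -/

section Casimir

variable {F R κ : Type*} [Field F] [Ring R] [Algebra F R] [Fintype κ]

/-- The twisted Casimir operator `u ↦ ∑ b k * u * d k`. -/
noncomputable def casimir (F : Type*) {R κ : Type*} [Field F] [Ring R] [Algebra F R] [Fintype κ]
    (b d : κ → R) : R →ₗ[F] R :=
  ∑ k, LinearMap.mulLeft F (b k) ∘ₗ LinearMap.mulRight F (d k)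

theorem casimir_apply (b d : κ → R) (u : R) : casimir F b d u = ∑ k, b k * u * d k := by
  simp [casimir, mul_assoc]

variable {t : R →ₗ[F] F} {b d : Module.Basis κ F R}

/-- Expanding in the dual bases turns both sides into the double sum of `t (d l * r * b k) • (b l *
u) ⊗ d k`. -/
theorem casimir_tmul (ht : ∀ x y, t (x * y) = t (y * x))
    (hb : ∀ x, x = ∑ k, t (x * d k) • b k) (hd : ∀ x, x = ∑ k, t (x * b k) • d k) (r u : R) :
    ∑ k, (r * b k * u) ⊗ₜ[F] MulOpposite.op (d k) =
      ∑ k, (b k * u) ⊗ₜ[F] MulOpposite.op (d k * r) := by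
  have h1 : ∀ k, (r * b k * u) ⊗ₜ[F] MulOpposite.op (d k) =
      ∑ l, t (d l * r * b k) • ((b l * u) ⊗ₜ[F] MulOpposite.op (d k)) := by
    intro k
    conv_lhs => rw [hb (r * b k), Finset.sum_mul, TensorProduct.sum_tmul]
    refine Finset.sum_congr rfl fun l _ => ?_
    rw [ht, ← mul_assoc, smul_mul_assoc, TensorProduct.smul_tmul']
  have h2 : ∀ l, (b l * u) ⊗ₜ[F] MulOpposite.op (d l * r) =
      ∑ k, t (d l * r * b k) • ((b l * u) ⊗ₜ[F] MulOpposite.op (d k)) := by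
    intro l
    conv_lhs => rw [hd (d l * r), ← MulOpposite.coe_opLinearEquiv F, map_sum, TensorProduct.tmul_sum]
    refine Finset.sum_congr rfl fun k _ => ?_
    rw [map_smul, TensorProduct.tmul_smul, MulOpposite.coe_opLinearEquiv]
  simp_rw [h1, h2]
  exact Finset.sum_comm

theorem casimir_comm (ht : ∀ x y, t (x * y) = t (y * x))
    (hb : ∀ x, x = ∑ k, t (x * d k) • b k) (hd : ∀ x, x = ∑ k, t (x * b k) • d k) (r u : R) :
    r * casimir F b d u = casimir F b d u * r := by
  have h := congrArg (fun z => TensorProduct.Algebra.moduleAux (M := R) z (1 : R))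
    (casimir_tmul ht hb hd r u)
  simp only [map_sum, LinearMap.sum_apply, TensorProduct.Algebra.moduleAux_apply] at h
  rw [casimir_apply, Finset.mul_sum, Finset.sum_mul]
  simpa [mul_assoc] using h

/-- The `d k`-coordinate of `z` is `t (z * b k)`, so the trace of `u ↦ x * u * y` in the basis `d`
is the sum of `t (x * d k * y * b k)`. -/
theorem form_casimir_mul (ht : ∀ x y, t (x * y) = t (y * x))
    (hd : ∀ x, x = ∑ k, t (x * b k) • d k) (x y : R) :
    t (casimir F b d x * y) =
      LinearMap.trace F R (LinearMap.mulLeft F x ∘ₗ LinearMap.mulRight F y) := by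
  classical
  have hrepr : ∀ z k, d.repr z k = t (z * b k) := by
    intro z k
    conv_lhs => rw [hd z]
    simp [Finsupp.single_apply]
  rw [LinearMap.trace_eq_matrix_trace F d, Matrix.trace, casimir_apply, Finset.sum_mul, map_sum]
  refine Finset.sum_congr rfl fun k _ => ?_
  rw [Matrix.diag_apply, LinearMap.toMatrix_apply, hrepr, ht _ (b k)]
  simp [mul_assoc]

theorem isSeparableAlgebra_of_casimir (ht : ∀ x y, t (x * y) = t (y * x))
    (hb : ∀ x, x = ∑ k, t (x * d k) • b k) (hd : ∀ x, x = ∑ k, t (x * b k) • d k)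
    {u : R} (hu : casimir F b d u = 1) : IsSeparableAlgebra F R := by
  refine isSeparableAlgebra_of_element (∑ k, (b k * u) ⊗ₜ MulOpposite.op (d k)) (fun r => ?_) ?_
  · rw [Finset.mul_sum, Finset.mul_sum]
    simpa [mul_assoc] using casimir_tmul ht hb hd r u
  · rw [map_sum, LinearMap.sum_apply]
    simpa [TensorProduct.Algebra.moduleAux_apply, casimir_apply] using hu

/-- A nondegenerate symmetric trace form admits dual bases. -/
theorem exists_dual_bases [FiniteDimensional F R] (ht : ∀ x y, t (x * y) = t (y * x))
    (hnd : ∀ x, (∀ y, t (x * y) = 0) → x = 0) :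
    ∃ (n : ℕ) (b d : Module.Basis (Fin n) F R),
      (∀ x, x = ∑ k, t (x * d k) • b k) ∧ ∀ x, x = ∑ k, t (x * b k) • d k := by
  let β : LinearMap.BilinForm F R := (LinearMap.mul F R).compr₂ t
  have hnd' : β.Nondegenerate :=
    ⟨fun x hx => hnd x hx, fun x hx => hnd x fun y => by rw [ht]; exact hx y⟩
  let b := Module.finBasis F R
  let d := β.dualBasis hnd' b
  have hdb : ∀ k l, t (d k * b l) = if l = k then 1 else 0 := fun k l =>
    LinearMap.BilinForm.apply_dualBasis_left hnd' b k l
  have hbd : ∀ k l, t (b k * d l) = if k = l then 1 else 0 := fun k l => by rw [ht, hdb]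
  refine ⟨_, b, d, fun x => ?_, fun x => ?_⟩
  · have hk : ∀ k, t (x * d k) = b.repr x k := fun k => by
      conv_lhs => rw [← b.sum_repr x, Finset.sum_mul, map_sum]
      simp [hbd]
    simp_rw [hk, b.sum_repr]
  · have hk : ∀ k, t (x * b k) = d.repr x k := fun k => by
      conv_lhs => rw [← d.sum_repr x, Finset.sum_mul, map_sum]
      simp [hdb]
    simp_rw [hk, d.sum_repr]

end Casimir

/-! ### Casimir operators after scalar extension -/

section BaseChangeCasimir

variable {F R κ : Type*} [Field F] [Ring R] [Algebra F R] [Fintype κ]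
  (E : Type*) [Field E] [Algebra F E] {t : R →ₗ[F] F} {b d : Module.Basis κ F R}

theorem baseChange_casimir_comm (ht : ∀ x y, t (x * y) = t (y * x))
    (hb : ∀ x, x = ∑ k, t (x * d k) • b k) (hd : ∀ x, x = ∑ k, t (x * b k) • d k)
    (y w : E ⊗[F] R) :
    y * (casimir F b d).baseChange E w = (casimir F b d).baseChange E w * y := by
  induction y with
  | zero => simp
  | add x y hx hy => simp only [add_mul, mul_add, hx, hy]
  | tmul a r =>
    induction w with
    | zero => simp
    | add x y hx hy => simp only [map_add, add_mul, mul_add, hx, hy]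
    | tmul c u => simp [casimir_comm ht hb hd r u, mul_comm a c]

theorem baseChangeForm_casimir_mul [FiniteDimensional F R] (ht : ∀ x y, t (x * y) = t (y * x))
    (hd : ∀ x, x = ∑ k, t (x * b k) • d k) (w y : E ⊗[F] R) :
    baseChangeForm E t ((casimir F b d).baseChange E w * y) =
      LinearMap.trace E (E ⊗[F] R) (LinearMap.mulLeft E w ∘ₗ LinearMap.mulRight E y) := by
  induction w with
  | zero => simp
  | add x y hx hy =>
    have h1 : LinearMap.mulLeft E (x + y) = LinearMap.mulLeft E x + LinearMap.mulLeft E y :=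
      map_add (LinearMap.mul E (E ⊗[F] R)) x y
    simp only [map_add, add_mul, hx, hy, h1, LinearMap.add_comp]
  | tmul a x =>
    induction y with
    | zero => simp
    | add x y hx hy =>
      have h1 : LinearMap.mulRight E (x + y) = LinearMap.mulRight E x + LinearMap.mulRight E y :=
        map_add (LinearMap.mul E (E ⊗[F] R)).flip x y
      simp only [map_add, mul_add, hx, hy, h1, LinearMap.comp_add]
    | tmul c y =>
      have h1 : LinearMap.mulLeft E (a ⊗ₜ[F] x) ∘ₗ LinearMap.mulRight E (c ⊗ₜ[F] y) =
          (a * c) • (LinearMap.mulLeft F x ∘ₗ LinearMap.mulRight F y).baseChange E := by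
        ext z
        simp [TensorProduct.smul_tmul']
      rw [h1, map_smul, LinearMap.trace_baseChange, ← form_casimir_mul ht hd]
      simp [Algebra.smul_def, mul_comm]

end BaseChangeCasimir

/-! ### Descent to `F`: the radical, separability and the section -/

namespace IsBimoduleEmbedding

variable {F N K : Type*} [Field F] [Ring N] [Algebra F N] [CommRing K] [Algebra F K]
  [Algebra.Etale F K] {i : K →ₐ[F] N} {θ : N →ₗ[F] K ⊗[F] K} {t : N →ₗ[F] F}

theorem form_mul_comm (h : IsBimoduleEmbedding i θ) (ht : ∀ k x, t (i k * x) = t (x * i k))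
    (ht' : ∀ k, t (i k) = Algebra.trace F K k) (x y : N) : t (x * y) = t (y * x) := by
  obtain ⟨ι, _, c, hc⟩ := h.exists_isMonomialSystem (AlgebraicClosure F) ht ht'
  have := hc.form_mul_comm (1 ⊗ₜ x) (1 ⊗ₜ y)
  simpa [Algebra.smul_def] using this

theorem mem_jacobson_iff (h : IsBimoduleEmbedding i θ) (ht : ∀ k x, t (i k * x) = t (x * i k))
    (ht' : ∀ k, t (i k) = Algebra.trace F K k) (hJ : ∀ x ∈ Ring.jacobson N, t x = 0) (x : N) :
    x ∈ Ring.jacobson N ↔ ∀ y, t (x * y) = 0 := by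
  refine ⟨fun hx y => hJ _ (Ideal.mul_mem_right _ _ hx), fun hx => ?_⟩
  have hK : Module.Finite F K := Algebra.FormallyUnramified.finite_of_free F K
  have hN : Module.Finite F N := Module.Finite.of_injective θ h.inj_map
  obtain ⟨ι, _, c, hc⟩ := h.exists_isMonomialSystem (AlgebraicClosure F) ht ht'
  have hcomm := h.form_mul_comm ht ht'
  -- Only nilpotency is descended from `E ⊗ N`. The radical is stable under left multiplication, so
  -- each `y * x` is nilpotent and `1 + y * x` is invertible.
  have hnil : ∀ z : N, (∀ y, t (z * y) = 0) → IsNilpotent z := by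
    intro z hz
    have hmem : (1 : AlgebraicClosure F) ⊗ₜ[F] z ∈ Ring.jacobson (AlgebraicClosure F ⊗[F] N) := by
      refine hc.radical_le_jacobson fun c => ?_
      induction c with
      | zero => simp
      | add x y hx hy => rw [mul_add, map_add, hx, hy, add_zero]
      | tmul a y => simp [hz]
    have : IsArtinianRing (AlgebraicClosure F ⊗[F] N) :=
      IsArtinianRing.of_finite (AlgebraicClosure F) _
    obtain ⟨n, hn⟩ := IsSemiprimaryRing.isNilpotent (R := AlgebraicClosure F ⊗[F] N)
    have hpow := Ideal.pow_mem_pow hmem n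
    rw [hn] at hpow
    refine ⟨n, Algebra.TensorProduct.includeRight_injective (R := F) (A := AlgebraicClosure F)
      (algebraMap F (AlgebraicClosure F)).injective ?_⟩
    rw [map_pow, map_zero]
    simpa using hpow
  rw [← Ideal.jacobson_bot, Ideal.mem_jacobson_iff]
  intro y
  have hyx : IsNilpotent (y * x) := hnil _ fun z => by rw [mul_assoc, hcomm, mul_assoc, hx]
  obtain ⟨v, hv⟩ := hyx.isUnit_one_add
  refine ⟨↑v⁻¹, ?_⟩
  have : (↑v⁻¹ : N) * (1 + y * x) = 1 := by rw [← hv, Units.inv_mul]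
  rw [Submodule.mem_bot, ← this]
  noncomm_ring

/-- If the Jacobson radical vanishes, the algebra is separable. -/
theorem isSeparableAlgebra (h : IsBimoduleEmbedding i θ) (hJ : Ring.jacobson N = ⊥) :
    IsSeparableAlgebra F N := by
  have hK : Module.Finite F K := Algebra.FormallyUnramified.finite_of_free F K
  have hN : Module.Finite F N := Module.Finite.of_injective θ h.inj_map
  obtain ⟨t, ht, ht', htJ⟩ := h.exists_form
  have hcomm := h.form_mul_comm ht ht'
  have hnd : ∀ x, (∀ y, t (x * y) = 0) → x = 0 := fun x hx => by
    have := (h.mem_jacobson_iff ht ht' htJ x).2 hx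
    rwa [hJ, Submodule.mem_bot] at this
  obtain ⟨n, b, d, hb, hd⟩ := exists_dual_bases hcomm hnd
  suffices hu : (1 : N) ∈ LinearMap.range (casimir F b d) by
    obtain ⟨u, hu⟩ := hu
    exact isSeparableAlgebra_of_casimir hcomm hb hd hu
  by_contra hu
  -- A functional killing the range but not `1` keeps both properties over `E`, where `1` will be
  -- shown to lie in the range.
  obtain ⟨f, hf1, hf⟩ := Submodule.exists_le_ker_of_notMem hu
  let E := AlgebraicClosure F
  obtain ⟨ι, _, c, hc⟩ := h.exists_isMonomialSystem E ht ht'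
  have hndE : ∀ z : E ⊗[F] N, (∀ y, baseChangeForm E t (z * y) = 0) → z = 0 := by
    intro z hz
    have hmem := mem_radical_baseChangeForm E hz
    have hle : Submodule.span E {y | ∃ x : N, (∀ y, t (x * y) = 0) ∧ (1 : E) ⊗ₜ[F] x = y} ≤ ⊥ := by
      rw [Submodule.span_le]
      rintro _ ⟨x, hx, rfl⟩
      simp [hnd x hx]
    exact hle hmem
  obtain ⟨w, hw⟩ := hc.exists_trace_eq_one hndE
  -- This element is central, so its product with each idempotent lies in a corner; the scalar there
  -- is the trace prescribed by the choice of `w`, namely `1`.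
  have hone : (casimir F b d).baseChange E w = 1 := by
    rw [← hc.complete.complete, ← hc.sum_mul_idem ((casimir F b d).baseChange E w)]
    refine Finset.sum_congr rfl fun j _ => ?_
    have h1 := baseChange_casimir_comm E hcomm hb hd
      (Algebra.TensorProduct.map (AlgHom.id E E) i (c j)) w
    have h2 := hw j
    rw [← baseChangeForm_casimir_mul E hcomm hd] at h2
    rw [hc.corner j ((casimir F b d).baseChange E w *
      Algebra.TensorProduct.map (AlgHom.id E E) i (c j)), h2, one_smul]
    rw [mul_assoc, mul_assoc, hc.idem_mul, ← mul_assoc, h1, mul_assoc, hc.idem_mul]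
  have hzero : ∀ z : E ⊗[F] N, baseChangeForm E f ((casimir F b d).baseChange E z) = 0 := by
    intro z
    induction z with
    | zero => simp
    | add x y hx hy => rw [map_add, map_add, hx, hy, add_zero]
    | tmul a x =>
      have : f (casimir F b d x) = 0 := hf ⟨x, rfl⟩
      simp [this]
  have := hzero w
  rw [hone, Algebra.TensorProduct.one_def, baseChangeForm_tmul, Algebra.smul_def, mul_one,
    FaithfulSMul.algebraMap_eq_zero_iff] at this
  exact hf1 this

/-- There is an idempotent of `K ⊗ K` acting as a projection of `N` onto its Jacobson radical. -/
theorem exists_jacobson_projection (h : IsBimoduleEmbedding i θ) :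
    ∃ g : K ⊗[F] K, (∀ x, bimoduleAct i g x ∈ Ring.jacobson N) ∧
      ∀ x ∈ Ring.jacobson N, bimoduleAct i g x = x := by
  have := isSemisimpleRing_tensorProduct_of_etale F K
  -- The image of `Jac(N)` under `θ` is an ideal because `Jac(N)` is a sub-bimodule; its idempotent
  -- generator is `g`.
  let I : Ideal (K ⊗[F] K) :=
    { carrier := {z | ∃ x ∈ Ring.jacobson N, θ x = z}
      add_mem' := by
        rintro _ _ ⟨x, hx, rfl⟩ ⟨y, hy, rfl⟩
        exact ⟨x + y, Ideal.add_mem _ hx hy, map_add _ _ _⟩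
      zero_mem' := ⟨0, Ideal.zero_mem _, map_zero _⟩
      smul_mem' := by
        rintro z _ ⟨x, hx, rfl⟩
        exact ⟨bimoduleAct i z x, bimoduleAct_mem i _ _ hx, h.map_act z x⟩ }
  obtain ⟨g, hg, hgI⟩ := I.exists_mem_forall_mul_eq
  refine ⟨g, fun x => ?_, fun x hx => h.inj_map ?_⟩
  · obtain ⟨y, hy, hxy⟩ := I.mul_mem_right (θ x) hg
    rw [← h.map_act] at hxy
    rwa [← h.inj_map hxy]
  · rw [h.map_act]
    exact hgI _ ⟨x, hx, rfl⟩

theorem ker_projection_mul_closed (h : IsBimoduleEmbedding i θ) {g : K ⊗[F] K}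
    (hg : ∀ x, bimoduleAct i g x ∈ Ring.jacobson N)
    (hg' : ∀ x ∈ Ring.jacobson N, bimoduleAct i g x = x) {x y : N}
    (hx : bimoduleAct i g x = 0) (hy : bimoduleAct i g y = 0) :
    bimoduleAct i g (x * y) = 0 := by
  obtain ⟨t, ht, ht', htJ⟩ := h.exists_form
  have hrad := h.mem_jacobson_iff ht ht' htJ
  let E := AlgebraicClosure F
  obtain ⟨ι, _, c, hc⟩ := h.exists_isMonomialSystem E ht ht'
  have key := hc.ker_mul_closed ((bimoduleAct i g).baseChange E)
    (fun j b => baseChange_act_mul E g (c j) b) (fun j b => baseChange_act_mul_right E g (c j) b)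
    (fun b z => ?_) (fun b hb => ?_) (b := 1 ⊗ₜ x) (c := 1 ⊗ₜ y) (by simp [hx]) (by simp [hy])
  · rw [Algebra.TensorProduct.tmul_mul_tmul, mul_one, LinearMap.baseChange_tmul] at key
    apply Algebra.TensorProduct.includeRight_injective (R := F) (A := E)
      (algebraMap F E).injective
    simpa using key
  · induction b with
    | zero => simp
    | add x y hx hy => rw [map_add, add_mul, map_add, hx, hy, add_zero]
    | tmul a x =>
      induction z with
      | zero => simp
      | add x y hx hy => rw [mul_add, map_add, hx, hy, add_zero]
      | tmul a' y => simp [(hrad _).1 (hg x) y]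
  · have hmem := mem_radical_baseChangeForm E hb
    have hle : Submodule.span E {y | ∃ x : N, (∀ y, t (x * y) = 0) ∧ (1 : E) ⊗ₜ[F] x = y} ≤
        LinearMap.eqLocus ((bimoduleAct i g).baseChange E) LinearMap.id := by
      rw [Submodule.span_le]
      rintro _ ⟨x, hx, rfl⟩
      simp [hg' x ((hrad x).2 hx)]
    exact hle hmem

/-- The quotient map by the Jacobson radical has a section compatible with `K`. -/
theorem exists_section (h : IsBimoduleEmbedding i θ) :
    ∃ s : N ⧸ Ring.jacobson N →ₐ[F] N,
      (∀ x, Ideal.Quotient.mk (Ring.jacobson N) (s x) = x) ∧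
      ∀ k, s (Ideal.Quotient.mk (Ring.jacobson N) (i k)) = i k := by
  have hK : Module.Finite F K := Algebra.FormallyUnramified.finite_of_free F K
  have hN : Module.Finite F N := Module.Finite.of_injective θ h.inj_map
  obtain ⟨g, hg, hg'⟩ := h.exists_jacobson_projection
  have hmul := fun {x y} => h.ker_projection_mul_closed hg hg' (x := x) (y := y)
  set q := bimoduleAct i g with hq
  have hsub : ∀ x, q (x - q x) = 0 := fun x => by rw [map_sub, hg' _ (hg x), sub_self]
  -- With `f = 1 - q 1`, the element `f - f * f = f * q 1` lies in both `ker q` and `Jac(N)`, hence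
  -- is zero. So `q 1` is idempotent, and it is nilpotent.
  have hq1 : q 1 = 0 := by
    have hf := hsub 1
    have hff := hmul hf hf
    have h1 : (1 - q 1) - (1 - q 1) * (1 - q 1) = (1 - q 1) * q 1 := by noncomm_ring
    have h2 : (1 - q 1) * q 1 = 0 := by
      rw [← hg' _ (Ideal.mul_mem_left _ (1 - q 1) (hg 1)), ← h1, map_sub, hf, hff, sub_self]
    have hidem : IsIdempotentElem (q 1) := by
      rw [sub_mul, one_mul, sub_eq_zero] at h2
      exact h2.symm
    have : IsArtinianRing N := IsArtinianRing.of_finite F N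
    obtain ⟨n, hn⟩ := IsSemiprimaryRing.isNilpotent (R := N)
    have hpow := Ideal.pow_mem_pow (hg 1) n
    rw [hn] at hpow
    have h3 : q 1 ^ n = 0 := by simpa using hpow
    rw [← hidem.pow_succ_eq n, pow_succ, h3, zero_mul]
  have hqi : ∀ k, q (i k) = 0 := fun k => by
    rw [← mul_one (i k), hq, bimoduleAct_mul_left, ← hq, hq1, mul_zero]
  let S : Subalgebra F N :=
    { carrier := {x | q x = 0}
      mul_mem' := fun hx hy => hmul hx hy
      add_mem' := fun {x y} hx hy => by
        rw [Set.mem_ofPred_eq] at *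
        rw [map_add, hx, hy, add_zero]
      algebraMap_mem' := fun r => by
        rw [Set.mem_ofPred_eq, ← i.commutes, hqi] }
  let f : S →ₐ[F] N ⧸ Ring.jacobson N := (Ideal.Quotient.mkₐ F (Ring.jacobson N)).comp S.val
  have hf : Function.Bijective f := by
    constructor
    · rw [injective_iff_map_eq_zero]
      intro x hx
      have hx' : (x : N) ∈ Ring.jacobson N := Ideal.Quotient.eq_zero_iff_mem.1 hx
      apply Subtype.ext
      rw [← hg' _ hx']
      exact x.2
    · intro y
      obtain ⟨x, rfl⟩ := Ideal.Quotient.mk_surjective y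
      refine ⟨⟨x - q x, hsub x⟩, ?_⟩
      change Ideal.Quotient.mk _ (x - q x) = _
      rw [map_sub, Ideal.Quotient.eq_zero_iff_mem.2 (hg x), sub_zero]
  let φ := AlgEquiv.ofBijective f hf
  refine ⟨S.val.comp φ.symm.toAlgHom, fun x => φ.apply_symm_apply x, fun k => ?_⟩
  have : φ.symm (Ideal.Quotient.mk (Ring.jacobson N) (i k)) = ⟨i k, hqi k⟩ := by
    rw [AlgEquiv.symm_apply_eq]
    rfl
  exact congrArg Subtype.val this

theorem separable_and_exists_section (h : IsBimoduleEmbedding i θ) :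
    IsSeparableAlgebra F (N ⧸ Ring.jacobson N) ∧
    ∃ s : N ⧸ Ring.jacobson N →ₐ[F] N, Function.Injective s ∧
      (∀ x, Ideal.Quotient.mk (Ring.jacobson N) (s x) = x) ∧
      IsCompl (Subalgebra.toSubmodule s.range) ((Ring.jacobson N).restrictScalars F) := by
  obtain ⟨s, hs, hsk⟩ := h.exists_section
  have hinj : Function.Injective s := Function.LeftInverse.injective hs
  constructor
  · let π := Ideal.Quotient.mkₐ F (Ring.jacobson N)
    -- Since `s` fixes `K`, it is a bimodule map, and the quotient inherits an embedding into `K ⊗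
    -- K` with vanishing Jacobson radical.
    have hemb : IsBimoduleEmbedding (π.comp i) (θ ∘ₗ s.toLinearMap) := by
      refine ⟨fun k k' hk => h.inj_hom ?_, h.inj_map.comp hinj, fun k k' x => ?_⟩
      · have := congrArg s hk
        rwa [AlgHom.comp_apply, AlgHom.comp_apply, Ideal.Quotient.mkₐ_eq_mk, hsk, hsk] at this
      · have : s ((π.comp i) k * x * (π.comp i) k') = i k * s x * i k' := by
          rw [map_mul, map_mul, AlgHom.comp_apply, AlgHom.comp_apply, Ideal.Quotient.mkₐ_eq_mk,
            hsk, hsk]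
        simp only [LinearMap.comp_apply, AlgHom.toLinearMap_apply, this, h.map_mul_mul]
    exact hemb.isSeparableAlgebra (Ring.jacobson_quotient_jacobson N)
  · refine ⟨s, hinj, hs, ?_⟩
    rw [isCompl_iff, disjoint_iff, codisjoint_iff, eq_bot_iff, eq_top_iff]
    constructor
    · rintro _ ⟨⟨x, rfl⟩, hx⟩
      have h0 : Ideal.Quotient.mk (Ring.jacobson N) (s x) = 0 := Ideal.Quotient.eq_zero_iff_mem.2 hx
      rw [hs] at h0
      simp [h0]
    · intro x _
      refine Submodule.mem_sup.2 ⟨s (Ideal.Quotient.mk _ x), ⟨_, rfl⟩,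
        x - s (Ideal.Quotient.mk _ x), ?_, add_sub_cancel _ _⟩
      change _ ∈ Ring.jacobson N
      rw [← Ideal.Quotient.eq_zero_iff_mem, map_sub, hs, sub_self]

end IsBimoduleEmbedding

/-! ### Minimally faithful modules and the embedding of the nucleus -/

section MinimallyFaithful

/-- A faithful module over a commutative semisimple ring has an element with zero annihilator. -/
theorem exists_smul_eq_zero_imp {T M : Type*} [CommRing T] [IsSemisimpleRing T] [AddCommGroup M]
    [Module T M] [FaithfulSMul T M] : ∃ a : M, ∀ z : T, z • a = 0 → z = 0 := by
  obtain ⟨_, ⟨a, rfl⟩, hmin⟩ := IsArtinian.set_has_minimal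
    (Set.range fun a : M => LinearMap.ker (LinearMap.toSpanSingleton T M a)) ⟨_, 0, rfl⟩
  refine ⟨a, fun z hz => ?_⟩
  obtain ⟨g, hg, hgI⟩ :=
    Ideal.exists_mem_forall_mul_eq (LinearMap.ker (LinearMap.toSpanSingleton T M a))
  have hga : g • a = 0 := hg
  suffices hg0 : g = 0 by rw [← hgI z hz, hg0, zero_mul]
  by_contra hg0
  obtain ⟨m, hm⟩ : ∃ m : M, g • m ≠ 0 := by
    by_contra! hm
    exact hg0 (FaithfulSMul.eq_of_smul_eq_smul (α := M) fun m => by rw [hm, zero_smul])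
  have hgg : g * g = g := hgI g hg
  -- As `g` kills `a` and fixes `g • m`, the annihilator of `a + g • m` lies in that of `a` but
  -- omits `g`, against minimality.
  refine hmin _ ⟨a + g • m, rfl⟩ (lt_of_le_of_ne ?_ fun heq => ?_)
  · intro y hy
    have hy' : y • a + y • g • m = 0 := by simpa using hy
    have h1 : g • (y • a + y • g • m) = y • g • m := by
      rw [smul_add, smul_comm g y a, hga, smul_zero, zero_add, smul_comm g y, smul_smul g g, hgg]
    rw [hy', smul_zero] at h1
    rw [← h1, add_zero] at hy'
    exact hy'
  · rw [SetLike.ext_iff] at heq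
    have h1 : g • (a + g • m) = 0 := (heq g).2 hg
    rw [smul_add, hga, zero_add, smul_smul, hgg] at h1
    exact hm h1

/-- A minimally faithful module over a commutative semisimple ring is free of rank one. -/
theorem IsMinimallyFaithful.nonempty_linearEquiv {T M : Type*} [CommRing T] [IsSemisimpleRing T]
    [AddCommGroup M] [Module T M] (h : IsMinimallyFaithful T M) : Nonempty (M ≃ₗ[T] T) := by
  obtain ⟨hf, hmin⟩ := h
  obtain ⟨a, ha⟩ := exists_smul_eq_zero_imp (T := T) (M := M)
  let f := LinearMap.toSpanSingleton T M a
  have hfaith : FaithfulSMul T (LinearMap.range f ⧸ (⊥ : Submodule T M).submoduleOf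
      (LinearMap.range f)) := by
    refine ⟨fun {z w} hzw => ?_⟩
    let a' : LinearMap.range f := ⟨a, 1, one_smul T a⟩
    have h1 := hzw (Submodule.Quotient.mk a')
    rw [← Submodule.Quotient.mk_smul, ← Submodule.Quotient.mk_smul, Submodule.Quotient.eq] at h1
    have h2 : z • a - w • a = 0 := h1
    rw [← sub_smul] at h2
    exact sub_eq_zero.1 (ha _ h2)
  -- The cyclic submodule on `a` is already faithful, so minimality makes it the whole module.
  obtain ⟨-, htop⟩ := hmin ⊥ (LinearMap.range f) bot_le hfaith
  refine ⟨(LinearEquiv.ofBijective f ⟨?_, LinearMap.range_eq_top.1 htop⟩).symm⟩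
  rw [injective_iff_map_eq_zero]
  exact ha

end MinimallyFaithful

open scoped IsMulCommutative in
/-- The nucleus of an algebra which is minimally faithful over `K ⊗ K` embeds into `K ⊗ K` as a
`K`-bimodule. -/
theorem IsMinimallyFaithfulOver.exists_isBimoduleEmbedding {F A : Type*} [Field F]
    [NonAssocRing A] [Module F A] [IsScalarTower F A A] [SMulCommClass F A A]
    {K : Subalgebra F (nucleus A)} [IsMulCommutative K] [Algebra.Etale F K]
    (h : IsMinimallyFaithfulOver F A K) :
    ∃ θ : nucleus A →ₗ[F] K ⊗[F] K, IsBimoduleEmbedding K.val θ := by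
  have := isSemisimpleRing_tensorProduct_of_etale F K
  let _ : Module (K ⊗[F] K) A := Module.compHom A (nucBiact F A K).toRingHom
  obtain ⟨φ⟩ := IsMinimallyFaithful.nonempty_linearEquiv (T := K ⊗[F] K) (M := A) h
  have hsmul : ∀ (c : F) (a : A), c • a = algebraMap F (K ⊗[F] K) c • a := fun c a => by
    change _ = nucBiact F A K (algebraMap F (K ⊗[F] K) c) a
    rw [AlgHom.commutes]
    rfl
  let θ : nucleus A →ₗ[F] K ⊗[F] K :=
    { toFun := fun x => φ (x : A)
      map_add' := fun x y => φ.map_add x y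
      map_smul' := fun c x => by
        change φ (c • (x : A)) = _
        rw [hsmul, φ.map_smul]
        exact (Algebra.smul_def c (φ (x : A))).symm }
  refine ⟨θ, Subtype.val_injective, φ.injective.comp Subtype.val_injective, fun k k' x => ?_⟩
  have h1 : ((k : nucleus A) : A) * x * ((k' : nucleus A) : A) =
      (k ⊗ₜ[F] k' : K ⊗[F] K) • (x : A) := (nucBiact_tmul F A K k k' x).symm
  change φ (((k : nucleus A) : A) * x * ((k' : nucleus A) : A)) = _
  rw [h1, φ.map_smul]
  rfl

theorem mainTheorem7 {F A : Type*} [Field F] [NonAssocRing A] [Module F A] [IsScalarTower F A A]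
    [SMulCommClass F A A] (hA : IsSemiassociative F A) :
    IsSeparableAlgebra F (semisimpleQuotient A) ∧
    ∃ s : semisimpleQuotient A →ₐ[F] nucleus A,
      Function.Injective s ∧
      (∀ x : semisimpleQuotient A, Ideal.Quotient.mk (Ring.jacobson (nucleus A)) (s x) = x) ∧
      IsCompl (Subalgebra.toSubmodule s.range)
        ((Ring.jacobson (nucleus A)).restrictScalars F) := by
  obtain ⟨-, -, K, hcomm, hK, hmin⟩ := hA
  obtain ⟨θ, hθ⟩ := hmin.exists_isBimoduleEmbedding
  open scoped IsMulCommutative in exact hθ.separable_and_exists_section
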